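/- **Theorem 2.4.** Let $\Gamma,\Sigma,\Lambda,\beta,L$ be strictly positive constants. Let $\mathcal T$ be the collection of all Lévy triplets $T=(\gamma,\sigma^2,\rho)$ with $|\gamma|\le\Gamma$, $\sigma\in(0,\Sigma]$, whose Lévy measure $\nu(dx)=\rho(x)\,dx$ has total mass $\nu(\mathbb R)=\int_{\mathbb R}\rho(u)\,du\in(0,\Lambda]$, and whose jump size density $f=\rho/\nu(\mathbb R)$, with characteristic function $\phi_f(t)=\int_{\mathbb R} e^{itu}f(u)\,du$, satisfies $$\int_{-\infty}^{\infty}|t|^{\beta}\,|\phi_f(t)|\,dt\le L .$$ This condition makes $\phi_f$ integrable, and $\rho$ denotes the continuous version of the Lévy density. For $T\in\mathcal T$ let $X=(X_t)_{t\ge 0}$ be, under $\operatorname{E}_T$, a Lévy process with triplet $T$, that is, with $$\operatorname{E}_T\bigl[e^{itX_1}\bigr]=\exp\Bigl(i\gamma t-\tfrac12\sigma^2t^2+\int_{\mathbb R}(e^{itu}-1)\rho(u)\,du\Bigr),\qquad t\in\mathbb R .$$ Then for every fixed $x\in\mathbb R$ there is a constant $c>0$, depending only on $\Gamma,\Sigma,\Lambda,\beta,L$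 and $x$, such that for all integers $n\ge 2$ $$\inf_{\widetilde\rho_n}\ \sup_{T\in\mathcal T}\ \operatorname{E}_T\bigl[(\widetilde\rho_n(x)-\rho(x))^2\bigr]\ \ge\ c\,(\log n)^{-\beta},$$ where the infimum is taken over all estimators $\widetilde\rho_n$ based on the observations $X_1,\dots,X_n$. -/

import Mathlib

open MeasureTheory ProbabilityTheory Filter Topology
open scoped NNReal ENNReal

noncomputable section

/-- A Lévy triplet `(γ, σ², ρ)` of finite jump activity: the Lévy measure is `ν(dx) = ρ(x) dx`
with `ν(ℝ) < ∞`. -/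
structure LevyTriplet where
  γ : ℝ
  σ : ℝ
  ρ : ℝ → ℝ
  σ_nonneg : 0 ≤ σ
  ρ_nonneg : ∀ x, 0 ≤ ρ x
  ρ_integrable : Integrable ρ

namespace LevyTriplet

/-- The total mass `ν(ℝ)` of the Lévy measure. -/
def mass (T : LevyTriplet) : ℝ := ∫ x, T.ρ x

/-- The jump size density `f = ρ / ν(ℝ)`. -/
def jumpDensity (T : LevyTriplet) (x : ℝ) : ℝ := T.ρ x / T.mass

/-- The characteristic function `φ_f(t) = ∫ e^{itx} f(x) dx` of the jump size density. -/
def jumpCharFun (T : LevyTriplet) (t : ℝ) : ℂ :=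
  ∫ x : ℝ, Complex.exp (Complex.I * t * x) * (T.jumpDensity x : ℂ)

/-- The Lévy exponent `ψ(t) = iγt - σ²t²/2 + ∫ (e^{itx} - 1) ρ(x) dx` (at time `1`). -/
def exponent (T : LevyTriplet) (t : ℝ) : ℂ :=
  Complex.I * T.γ * t - (T.σ : ℂ) ^ 2 * (t : ℂ) ^ 2 / 2
    + ∫ x : ℝ, (Complex.exp (Complex.I * t * x) - 1) * (T.ρ x : ℂ)

end LevyTriplet

/-- A real-valued Lévy process on the probability space `(Ω, P)`. -/
structure IsLevyProcess {Ω : Type*} [MeasurableSpace Ω] (X : ℝ≥0 → Ω → ℝ) (P : Measure Ω) :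
    Prop where
  isProbabilityMeasure : IsProbabilityMeasure P
  measurable : ∀ t, Measurable (X t)
  zero_ae : ∀ᵐ ω ∂P, X 0 ω = 0
  indep_increments : HasIndepIncrements X P
  stationary_increments : ∀ s t, IdentDistrib (fun ω => X (s + t) ω - X s ω) (X t) P P
  stochastically_continuous : ∀ t, TendstoInMeasure P X (𝓝 t) (X t)
  cadlag : ∀ᵐ ω ∂P, ∀ t, ContinuousWithinAt (fun s => X s ω) (Set.Ici t) t ∧
    ∃ l : ℝ, Tendsto (fun s => X s ω) (𝓝[<] t) (𝓝 l)

/-- `X` is a Lévy process with Lévy triplet `T`: the characteristic function of `X₁` is `e^ψ`. -/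
structure IsLevyProcessWithTriplet {Ω : Type*} [MeasurableSpace Ω] (X : ℝ≥0 → Ω → ℝ)
    (P : Measure Ω) (T : LevyTriplet) : Prop extends IsLevyProcess X P where
  charFun_one : ∀ t : ℝ, charFun (P.map (X 1)) t = Complex.exp (T.exponent t)

/-- The class of triplets with `|γ| ≤ Γ`, `σ ∈ (0, Σ]`, `ν(ℝ) ∈ (0, Λ]` and
`∫ |t|^β |φ_f(t)| dt ≤ L`. This last bound makes `φ_f` integrable, so that `ρ` has a unique
continuous version; `ρ(x)` at a point `x` means the value of that version. -/
def levyClass (Γ S Λ β L : ℝ) : Set LevyTriplet :=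
  {T | |T.γ| ≤ Γ ∧ T.σ ∈ Set.Ioc 0 S ∧ T.mass ∈ Set.Ioc 0 Λ ∧ Continuous T.ρ ∧
    ∫⁻ t : ℝ, ENNReal.ofReal (|t| ^ β * ‖T.jumpCharFun t‖) ≤ ENNReal.ofReal L}

/-- The observations `(X₁, …, Xₙ)`. -/
def observations {Ω : Type*} (X : ℝ≥0 → Ω → ℝ) (n : ℕ) (ω : Ω) : Fin n → ℝ :=
  fun i => X ((i : ℕ) + 1 : ℝ≥0) ω

/-- An estimator of a function on `ℝ` based on `n` real observations `z`: its value at every point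
is a measurable function of the observations. -/
def IsEstimator {n : ℕ} (r : (Fin n → ℝ) → ℝ → ℝ) : Prop := ∀ x, Measurable fun z => r z x

/-- The mean square error `E[(r(X₁, …, Xₙ)(x) - ρ(x))²]` at the point `x`, with values in
`[0, ∞]`. -/
def meanSquareError {Ω : Type*} [MeasurableSpace Ω] (X : ℝ≥0 → Ω → ℝ) (P : Measure Ω)
    (ρ : ℝ → ℝ) {n : ℕ} (r : (Fin n → ℝ) → ℝ → ℝ) (x : ℝ) : ℝ≥0∞ :=
  ∫⁻ ω, ENNReal.ofReal ((r (observations X n ω) x - ρ x) ^ 2) ∂P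

end

/-! The bound is Le Cam's two point argument. Both alternatives have `γ = 0`, `σ = S` and the same
intensity `l`. One jump density is a wide Gaussian centred at `x`; the other is that Gaussian
multiplied by `1 + η cos (a (u - x))` and renormalised. In the Fourier domain the modulation adds
bumps at `±a`, so the smoothness constraint allows `η` of order `a ^ (-β)`, and the two Lévy
densities differ at `x` by order `η`.

The Gaussian part of the process hides the modulation. Convolution with `N(0, s)` turns a modulated
Gaussian into another one whose amplitude is damped by `exp (-C a²)`, where `C = v s / (2 (v + s))`
(`modulatedGaussian_conv_gaussianReal`). The damping survives in the compound Poisson law, because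
each jump can be exchanged while the Gaussian noise is still present (`SetwiseLe.compoundPoisson`).
With `C a² = log n` the laws of `X₁` differ by `O(1/n)`, so those of `n` increments stay within
`1/2`. The squared separation is of order `a ^ (-2β)`, that is `(log n) ^ (-β)`. -/

/-! ### Total variation comparison and the two point bound -/

/-- `μ` exceeds `ν` by at most `ε` on every measurable set. For probability measures this says that
their total variation distance is at most `ε`. -/
def SetwiseLe {α : Type*} [MeasurableSpace α] (μ ν : Measure α) (ε : ℝ≥0∞) : Prop :=
  ∀ A, MeasurableSet A → μ A ≤ ν A + ε

namespace SetwiseLe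

variable {α β : Type*} [MeasurableSpace α] [MeasurableSpace β]

lemma trans {μ ν κ : Measure α} {ε δ : ℝ≥0∞} (h₁ : SetwiseLe μ ν ε) (h₂ : SetwiseLe ν κ δ) :
    SetwiseLe μ κ (δ + ε) := fun A hA => by
  rw [← add_assoc]
  exact (h₁ A hA).trans (by gcongr; exact h₂ A hA)

lemma mono {μ ν : Measure α} {ε δ : ℝ≥0∞} (h : SetwiseLe μ ν ε) (hε : ε ≤ δ) :
    SetwiseLe μ ν δ := fun A hA => (h A hA).trans (by gcongr)

lemma map {μ ν : Measure α} {ε : ℝ≥0∞} (h : SetwiseLe μ ν ε) {f : α → β} (hf : Measurable f) :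
    SetwiseLe (μ.map f) (ν.map f) ε := fun A hA => by
  rw [Measure.map_apply hf hA, Measure.map_apply hf hA]
  exact h _ (hf hA)

lemma prod_left (κ : Measure α) [IsProbabilityMeasure κ] {μ ν : Measure β} [SFinite μ] [SFinite ν]
    {ε : ℝ≥0∞} (h : SetwiseLe μ ν ε) : SetwiseLe (κ.prod μ) (κ.prod ν) ε := fun A hA => by
  rw [Measure.prod_apply hA, Measure.prod_apply hA]
  calc ∫⁻ x, μ (Prod.mk x ⁻¹' A) ∂κ ≤ ∫⁻ x, (ν (Prod.mk x ⁻¹' A) + ε) ∂κ :=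
        lintegral_mono fun x => h _ (measurable_prodMk_left hA)
    _ = _ := by rw [lintegral_add_right _ measurable_const]; simp

lemma prod_right (κ : Measure β) [IsProbabilityMeasure κ] {μ ν : Measure α} [SFinite μ] [SFinite ν]
    {ε : ℝ≥0∞} (h : SetwiseLe μ ν ε) : SetwiseLe (μ.prod κ) (ν.prod κ) ε := by
  rw [← Measure.prod_swap (μ := κ) (ν := μ), ← Measure.prod_swap (μ := κ) (ν := ν)]
  exact (prod_left κ h).map measurable_swap

/-- Coordinates are exchanged one at a time, each at cost `ε`. -/
lemma pi {μ ν : Measure ℝ} [IsProbabilityMeasure μ] [IsProbabilityMeasure ν] {ε : ℝ≥0∞}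
    (h : SetwiseLe μ ν ε) (n : ℕ) :
    SetwiseLe (Measure.pi fun _ : Fin n => μ) (Measure.pi fun _ : Fin n => ν) (n * ε) := by
  induction n with
  | zero =>
    intro A hA
    rw [Measure.pi_of_empty (fun _ : Fin 0 => μ), Measure.pi_of_empty (fun _ : Fin 0 => ν)]
    simp
  | succ n ih =>
    have key (κ : Measure ℝ) [IsProbabilityMeasure κ] :
        (κ.prod (Measure.pi fun _ : Fin n => κ)).map
          (MeasurableEquiv.piFinSuccAbove (fun _ : Fin (n + 1) => ℝ) 0).symm =
          Measure.pi fun _ : Fin (n + 1) => κ :=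
      ((measurePreserving_piFinSuccAbove (fun _ : Fin (n + 1) => κ) 0).symm _).map_eq
    rw [← key μ, ← key ν]
    have := (prod_left μ ih).trans (prod_right (Measure.pi fun _ : Fin n => ν) h)
    refine (this.mono ?_).map (MeasurableEquiv.measurable _)
    push_cast
    rw [add_mul, one_mul, add_comm]

lemma conv_left (κ : Measure ℝ) [IsProbabilityMeasure κ] {μ ν : Measure ℝ} [SFinite μ] [SFinite ν]
    {ε : ℝ≥0∞} (h : SetwiseLe μ ν ε) : SetwiseLe (κ ∗ μ) (κ ∗ ν) ε :=
  (prod_left κ h).map measurable_add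

/-- **Le Cam's two point bound** for the quadratic loss. -/
lemma le_lintegral_sq_add {μ ν : Measure α} [IsProbabilityMeasure μ]
    (h : SetwiseLe μ ν 2⁻¹) {r : α → ℝ} (hr : Measurable r) (a b : ℝ) :
    ENNReal.ofReal ((a - b) ^ 2 / 8) ≤
      (∫⁻ z, ENNReal.ofReal ((r z - a) ^ 2) ∂μ) + ∫⁻ z, ENNReal.ofReal ((r z - b) ^ 2) ∂ν := by
  -- Off `A` the loss under `μ` is at least `(a - b)² / 4`; on `A` the estimate is far from `b`, and
  -- the same holds under `ν`.
  set A : Set α := {z | |r z - a| < |a - b| / 2}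
  have hA : MeasurableSet A := measurableSet_lt (by fun_prop) measurable_const
  set D : ℝ≥0∞ := ENNReal.ofReal ((a - b) ^ 2 / 4)
  have hmass : 2⁻¹ ≤ μ Aᶜ + ν A := by
    have h1 : (1 : ℝ≥0∞) ≤ μ Aᶜ + ν A + 2⁻¹ := by
      rw [← prob_add_prob_compl (μ := μ) hA, add_comm (μ A), add_assoc]
      gcongr
      exact h A hA
    rw [← ENNReal.inv_two_add_inv_two] at h1
    exact (ENNReal.add_le_add_iff_right (by simp)).1 h1
  have hμ : D * μ Aᶜ ≤ ∫⁻ z, ENNReal.ofReal ((r z - a) ^ 2) ∂μ := by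
    rw [← setLIntegral_const]
    refine (setLIntegral_mono (by fun_prop) fun z hz => ?_).trans (setLIntegral_le_lintegral _ _)
    have hz' : |a - b| / 2 ≤ |r z - a| := not_lt.1 hz
    refine ENNReal.ofReal_le_ofReal ?_
    rw [← sq_abs (a - b), ← sq_abs (r z - a)]
    nlinarith [abs_nonneg (a - b)]
  have hν : D * ν A ≤ ∫⁻ z, ENNReal.ofReal ((r z - b) ^ 2) ∂ν := by
    rw [← setLIntegral_const]
    refine (setLIntegral_mono (by fun_prop) fun z hz => ?_).trans (setLIntegral_le_lintegral _ _)
    have hz' : |r z - a| < |a - b| / 2 := hz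
    have hz'' : |a - b| / 2 ≤ |r z - b| := by
      have := abs_sub_le a (r z) b
      rw [abs_sub_comm a (r z)] at this
      linarith
    refine ENNReal.ofReal_le_ofReal ?_
    rw [← sq_abs (a - b), ← sq_abs (r z - b)]
    nlinarith [abs_nonneg (a - b)]
  calc ENNReal.ofReal ((a - b) ^ 2 / 8) = D * 2⁻¹ := by
        rw [show (2⁻¹ : ℝ≥0∞) = ENNReal.ofReal 2⁻¹ by
          rw [ENNReal.ofReal_inv_of_pos two_pos]; simp, ← ENNReal.ofReal_mul (by positivity)]
        congr 1; ring
    _ ≤ D * (μ Aᶜ + ν A) := by gcongr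
    _ ≤ _ := by rw [mul_add]; gcongr

end SetwiseLe

/-! ### Compound Poisson laws with additive noise -/

/-- The `k`-fold convolution power of `F`, convolved with `N`. -/
noncomputable def convIter (F N : Measure ℝ) : ℕ → Measure ℝ
  | 0 => N
  | k + 1 => F ∗ convIter F N k

instance (F N : Measure ℝ) [IsProbabilityMeasure F] [IsProbabilityMeasure N] (k : ℕ) :
    IsProbabilityMeasure (convIter F N k) := by
  induction k with
  | zero => simpa [convIter]
  | succ k ih => simp only [convIter]; infer_instance

lemma charFun_convIter (F N : Measure ℝ) [IsProbabilityMeasure F] [IsProbabilityMeasure N] (k : ℕ)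
    (t : ℝ) : charFun (convIter F N k) t = charFun F t ^ k * charFun N t := by
  induction k with
  | zero => simp [convIter]
  | succ k ih => simp only [convIter]; rw [charFun_conv, ih]; ring

/-- The factors `F₀` are exchanged for `F₁` one by one. By commutativity the factor being exchanged
can be placed next to `N`, so only the smoothed laws `F₀ ∗ N` and `F₁ ∗ N` need to be close. -/
lemma SetwiseLe.convIter {F₀ F₁ N : Measure ℝ} [IsProbabilityMeasure F₀] [IsProbabilityMeasure F₁]
    [IsProbabilityMeasure N] {ε : ℝ≥0∞} (h : SetwiseLe (F₀ ∗ N) (F₁ ∗ N) ε) (k : ℕ) :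
    SetwiseLe (convIter F₀ N k) (convIter F₁ N k) (k * ε) := by
  have hstep (k : ℕ) : SetwiseLe (F₀ ∗ _root_.convIter F₁ N k) (F₁ ∗ _root_.convIter F₁ N k) ε := by
    induction k with
    | zero => simpa [_root_.convIter] using h
    | succ k ih =>
      simp only [_root_.convIter]
      rw [← Measure.conv_assoc, Measure.conv_comm F₀ F₁, Measure.conv_assoc]
      exact ih.conv_left F₁
  induction k with
  | zero => intro A _; simp [_root_.convIter]
  | succ k ih =>
    refine ((ih.conv_left F₀).trans (hstep k)).mono ?_
    push_cast
    rw [add_mul, one_mul, add_comm]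

/-- The compound Poisson law with intensity `l` and jump law `F`, convolved with `N`. -/
noncomputable def compoundPoisson (l : ℝ) (F N : Measure ℝ) : Measure ℝ :=
  Measure.sum fun k : ℕ => ENNReal.ofReal (Real.exp (-l) * l ^ k / k.factorial) • convIter F N k

lemma hasSum_poisson (l : ℝ) : HasSum (fun k : ℕ => Real.exp (-l) * l ^ k / k.factorial) 1 := by
  have := (NormedSpace.expSeries_div_hasSum_exp (𝔸 := ℝ) l).mul_left (Real.exp (-l))
  rw [← Real.exp_eq_exp_ℝ, ← Real.exp_add, neg_add_cancel, Real.exp_zero] at this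
  simpa [mul_div_assoc] using this

lemma tsum_poisson {l : ℝ} (hl : 0 ≤ l) :
    ∑' k : ℕ, ENNReal.ofReal (Real.exp (-l) * l ^ k / k.factorial) = 1 := by
  rw [← ENNReal.ofReal_tsum_of_nonneg (fun k => by positivity) (hasSum_poisson l).summable,
    (hasSum_poisson l).tsum_eq, ENNReal.ofReal_one]

lemma tsum_poisson_mul {l : ℝ} (hl : 0 ≤ l) :
    ∑' k : ℕ, ENNReal.ofReal (Real.exp (-l) * l ^ k / k.factorial) * k = ENNReal.ofReal l := by
  rw [tsum_eq_zero_add' ENNReal.summable]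
  have h (k : ℕ) : ENNReal.ofReal (Real.exp (-l) * l ^ (k + 1) / (k + 1).factorial) * ↑(k + 1) =
      ENNReal.ofReal l * ENNReal.ofReal (Real.exp (-l) * l ^ k / k.factorial) := by
    rw [← ENNReal.ofReal_natCast (k + 1), ← ENNReal.ofReal_mul (by positivity),
      ← ENNReal.ofReal_mul hl, Nat.factorial_succ]
    congr 1
    push_cast
    field_simp
    ring
  simp_rw [h, ENNReal.tsum_mul_left, tsum_poisson hl]
  simp

lemma isProbabilityMeasure_compoundPoisson {l : ℝ} (hl : 0 ≤ l) (F N : Measure ℝ)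
    [IsProbabilityMeasure F] [IsProbabilityMeasure N] :
    IsProbabilityMeasure (compoundPoisson l F N) where
  measure_univ := by
    rw [compoundPoisson, Measure.sum_apply _ MeasurableSet.univ]
    simpa using tsum_poisson hl

lemma charFun_compoundPoisson {l : ℝ} (hl : 0 ≤ l) (F N : Measure ℝ)
    [IsProbabilityMeasure F] [IsProbabilityMeasure N] (t : ℝ) :
    charFun (compoundPoisson l F N) t =
      Complex.exp (l * (charFun F t - 1)) * charFun N t := by
  have := isProbabilityMeasure_compoundPoisson hl F N
  have hint : Integrable (fun x : ℝ => Complex.exp (t * x * Complex.I))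
      (compoundPoisson l F N) := by
    refine Integrable.of_bound (C := 1) (by fun_prop) (ae_of_all _ fun x => ?_)
    rw [← Complex.ofReal_mul, Complex.norm_exp_ofReal_mul_I]
  rw [charFun_apply_real]
  have h1 := hasSum_integral_measure hint
  have h2 := ((NormedSpace.expSeries_div_hasSum_exp (𝔸 := ℂ) (l * charFun F t)).mul_left
    (Complex.exp (-l))).mul_right (charFun N t)
  rw [← Complex.exp_eq_exp_ℂ, ← Complex.exp_add] at h2
  rw [show (l : ℂ) * (charFun F t - 1) = -l + l * charFun F t by ring]
  refine h1.unique (h2.congr_fun ?_)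
  intro k
  rw [integral_smul_measure, ← charFun_apply_real, charFun_convIter,
    ENNReal.toReal_ofReal (by positivity), Complex.real_smul]
  push_cast
  rw [mul_pow]
  ring

/-- Given `k` jumps the cost is `k * ε`; averaging over the Poisson number of jumps gives its mean
`l` times `ε`. -/
lemma SetwiseLe.compoundPoisson {F₀ F₁ N : Measure ℝ} [IsProbabilityMeasure F₀]
    [IsProbabilityMeasure F₁] [IsProbabilityMeasure N] {ε : ℝ≥0∞}
    (h : SetwiseLe (F₀ ∗ N) (F₁ ∗ N) ε) {l : ℝ} (hl : 0 ≤ l) :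
    SetwiseLe (compoundPoisson l F₀ N) (compoundPoisson l F₁ N) (ENNReal.ofReal l * ε) := by
  intro A hA
  simp only [_root_.compoundPoisson, Measure.sum_apply _ hA, Measure.smul_apply, smul_eq_mul]
  rw [← tsum_poisson_mul hl, ← ENNReal.tsum_mul_right, ← ENNReal.tsum_add]
  refine ENNReal.tsum_le_tsum fun k => ?_
  rw [mul_assoc, ← mul_add]
  gcongr
  exact h.convIter k A hA

/-! ### Modulated Gaussian densities -/

/-- The Gaussian density with mean `m` and variance `v`, modulated by
`(1 + η cos (a (u - m))) / q`. -/
noncomputable def modulatedPDF (m : ℝ) (v : ℝ≥0) (a η q u : ℝ) : ℝ :=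
  gaussianPDFReal m v u * ((1 + η * Real.cos (a * (u - m))) / q)

/-- The Fourier transform of `modulatedPDF 0 v a η 1`. -/
noncomputable def modulatedEnvelope (v : ℝ≥0) (a η t : ℝ) : ℝ :=
  Real.exp (-(v * t ^ 2 / 2)) +
    η / 2 * (Real.exp (-(v * (t + a) ^ 2 / 2)) + Real.exp (-(v * (t - a) ^ 2 / 2)))

/-- The measure with density `modulatedPDF m v a η q`. -/
noncomputable def modulatedGaussian (m : ℝ) (v : ℝ≥0) (a η q : ℝ) : Measure ℝ :=
  volume.withDensity fun u => ENNReal.ofReal (modulatedPDF m v a η q u)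

section

variable {m : ℝ} {v : ℝ≥0} {a η q : ℝ}

lemma one_add_mul_cos_nonneg (hη : 0 ≤ η) (hη1 : η ≤ 1) (y : ℝ) : 0 ≤ 1 + η * Real.cos y := by
  nlinarith [Real.neg_one_le_cos y]

lemma modulatedPDF_nonneg (hη : 0 ≤ η) (hη1 : η ≤ 1) (hq : 0 < q) (u : ℝ) :
    0 ≤ modulatedPDF m v a η q u :=
  mul_nonneg (gaussianPDFReal_nonneg m v u)
    (div_nonneg (one_add_mul_cos_nonneg hη hη1 _) hq.le)

lemma continuous_modulatedPDF : Continuous (modulatedPDF m v a η q) := by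
  unfold modulatedPDF
  rw [gaussianPDFReal_def]
  fun_prop

lemma integrable_modulatedPDF : Integrable (modulatedPDF m v a η q) := by
  refine (integrable_gaussianPDFReal m v).mul_bdd (c := (1 + |η|) / |q|)
    (by fun_prop) (ae_of_all _ fun u => ?_)
  rw [Real.norm_eq_abs, abs_div]
  gcongr
  refine (abs_add_le _ _).trans ?_
  rw [abs_one, abs_mul]
  gcongr
  exact mul_le_of_le_one_right (abs_nonneg _) (Real.abs_cos_le_one _)

instance : IsFiniteMeasure (modulatedGaussian m v a η q) :=
  isFiniteMeasure_withDensity_ofReal integrable_modulatedPDF.2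

lemma integral_modulatedGaussian (hη : 0 ≤ η) (hη1 : η ≤ 1) (hq : 0 < q) (g : ℝ → ℂ) :
    ∫ u, g u ∂modulatedGaussian m v a η q = ∫ u, g u * (modulatedPDF m v a η q u : ℂ) := by
  rw [modulatedGaussian, integral_withDensity_eq_integral_toReal_smul
    continuous_modulatedPDF.measurable.ennreal_ofReal (by simp)]
  refine integral_congr_ae (ae_of_all _ fun u => ?_)
  simp only [ENNReal.toReal_ofReal (modulatedPDF_nonneg hη hη1 hq u), Complex.real_smul]
  ring

/-- The cosine splits into two exponentials, which shift the Gaussian characteristic function by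
`±a`. -/
lemma charFun_modulatedGaussian (hv : v ≠ 0) (hη : 0 ≤ η) (hη1 : η ≤ 1) (hq : 0 < q) (t : ℝ) :
    charFun (modulatedGaussian m v a η q) t =
      Complex.exp (m * t * Complex.I) * ((modulatedEnvelope v a η t / q : ℝ) : ℂ) := by
  have hint (s : ℝ) : Integrable (fun u : ℝ => Complex.exp (s * u * Complex.I))
      (gaussianReal m v) := by
    refine Integrable.of_bound (C := 1) (by fun_prop) (ae_of_all _ fun u => ?_)
    rw [← Complex.ofReal_mul, Complex.norm_exp_ofReal_mul_I]
  have hexp (u : ℝ) : modulatedPDF m v a η q u * Complex.exp (t * u * Complex.I) =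
      gaussianPDFReal m v u • ((q : ℂ)⁻¹ * (Complex.exp (t * u * Complex.I) +
        η / 2 * (Complex.exp (-(a * m * Complex.I)) * Complex.exp ((t + a : ℝ) * u * Complex.I) +
          Complex.exp (a * m * Complex.I) * Complex.exp ((t - a : ℝ) * u * Complex.I)))) := by
    have h1 : Complex.exp (-(a * m * Complex.I)) * Complex.exp ((t + a : ℝ) * u * Complex.I) =
        Complex.exp (t * u * Complex.I) * Complex.exp (a * (u - m) * Complex.I) := by
      rw [← Complex.exp_add, ← Complex.exp_add]; congr 1; push_cast; ring
    have h2 : Complex.exp (a * m * Complex.I) * Complex.exp ((t - a : ℝ) * u * Complex.I) =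
        Complex.exp (t * u * Complex.I) * Complex.exp (-(a * (u - m)) * Complex.I) := by
      rw [← Complex.exp_add, ← Complex.exp_add]; congr 1; push_cast; ring
    rw [h1, h2, Complex.real_smul, modulatedPDF]
    push_cast
    rw [Complex.cos]
    ring
  have hint₂ : Integrable (fun u : ℝ => (η : ℂ) / 2 *
      (Complex.exp (-(a * m * Complex.I)) * Complex.exp ((t + a : ℝ) * u * Complex.I) +
        Complex.exp (a * m * Complex.I) * Complex.exp ((t - a : ℝ) * u * Complex.I)))
      (gaussianReal m v) :=
    (((hint _).const_mul _).add ((hint _).const_mul _)).const_mul _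
  rw [charFun_apply_real, integral_modulatedGaussian hη hη1 hq]
  simp_rw [mul_comm (Complex.exp _) ((modulatedPDF m v a η q _ : ℝ) : ℂ), hexp]
  rw [← integral_gaussianReal_eq_integral_smul hv, integral_const_mul, integral_add (hint t) hint₂,
    integral_const_mul,
    integral_add ((hint _).const_mul _) ((hint _).const_mul _), integral_const_mul,
    integral_const_mul, ← charFun_apply_real, ← charFun_apply_real, ← charFun_apply_real,
    charFun_gaussianReal, charFun_gaussianReal, charFun_gaussianReal]
  have h1 : Complex.exp (-(a * m * Complex.I)) *
      Complex.exp ((t + a : ℝ) * m * Complex.I - v * ((t + a : ℝ) : ℂ) ^ 2 / 2) =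
      Complex.exp (m * t * Complex.I) * Complex.exp (-(v * (t + a) ^ 2 / 2)) := by
    rw [← Complex.exp_add, ← Complex.exp_add]; congr 1; push_cast; ring
  have h2 : Complex.exp (a * m * Complex.I) *
      Complex.exp ((t - a : ℝ) * m * Complex.I - v * ((t - a : ℝ) : ℂ) ^ 2 / 2) =
      Complex.exp (m * t * Complex.I) * Complex.exp (-(v * (t - a) ^ 2 / 2)) := by
    rw [← Complex.exp_add, ← Complex.exp_add]; congr 1; push_cast; ring
  have h3 : Complex.exp (t * m * Complex.I - v * (t : ℂ) ^ 2 / 2) =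
      Complex.exp (m * t * Complex.I) * Complex.exp (-(v * t ^ 2 / 2)) := by
    rw [← Complex.exp_add]; congr 1; ring
  rw [h1, h2, h3, modulatedEnvelope]
  push_cast
  ring

lemma isProbabilityMeasure_modulatedGaussian (hv : v ≠ 0) (hη : 0 ≤ η) (hη1 : η ≤ 1)
    (hq : q = 1 + η * Real.exp (-(v * a ^ 2 / 2))) :
    IsProbabilityMeasure (modulatedGaussian m v a η q) := by
  have hq0 : 0 < q := by rw [hq]; positivity
  have h := charFun_modulatedGaussian (m := m) (a := a) hv hη hη1 hq0 0
  rw [charFun_zero] at h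
  have h' : modulatedEnvelope v a η 0 / q = 1 := by
    rw [div_eq_one_iff_eq hq0.ne', hq, modulatedEnvelope]
    simp
    ring
  rw [h'] at h
  have h'' : (modulatedGaussian m v a η q).real Set.univ = 1 := by
    simpa using h
  constructor
  rw [measureReal_def, ENNReal.toReal_eq_one_iff] at h''
  exact h''

end

/-- Completing the square: `v (t + a)² + s t² = w (t + v a / w)² + (v s / w) a²`. The last term is
the damping of the amplitude. -/
lemma modulatedEnvelope_mul_exp {v s w : ℝ≥0} (hw : w = v + s) (hw0 : w ≠ 0) (a η t : ℝ) :
    modulatedEnvelope v a η t * Real.exp (-(s * t ^ 2 / 2)) =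
      modulatedEnvelope w (v / w * a) (η * Real.exp (-(v * s / (2 * w) * a ^ 2))) t := by
  have hw' : (w : ℝ) ≠ 0 := by exact_mod_cast hw0
  have hv : (v : ℝ) = w - s := by rw [hw]; push_cast; ring
  have h (a : ℝ) : Real.exp (-(v * (t + a) ^ 2 / 2)) * Real.exp (-(s * t ^ 2 / 2)) =
      Real.exp (-(v * s / (2 * w) * a ^ 2)) * Real.exp (-(w * (t + v / w * a) ^ 2 / 2)) := by
    rw [← Real.exp_add, ← Real.exp_add]
    congr 1
    rw [hv]
    field_simp
    ring
  have h1 := h a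
  have h2 := h (-a)
  have h3 : Real.exp (-(v * t ^ 2 / 2)) * Real.exp (-(s * t ^ 2 / 2)) =
      Real.exp (-(w * t ^ 2 / 2)) := by simpa using h 0
  simp only [neg_sq, mul_neg, ← sub_eq_add_neg] at h2
  simp only [modulatedEnvelope]
  linear_combination h3 + η / 2 * (h1 + h2)

lemma modulatedGaussian_conv_gaussianReal {m : ℝ} {v s w : ℝ≥0} (hv : v ≠ 0) (hw : w = v + s)
    {a η q : ℝ} (hη : 0 ≤ η) (hη1 : η ≤ 1) (hq : 0 < q) :
    modulatedGaussian m v a η q ∗ gaussianReal 0 s =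
      modulatedGaussian m w (v / w * a) (η * Real.exp (-(v * s / (2 * w) * a ^ 2))) q := by
  have hw0 : w ≠ 0 := by
    rw [hw]; exact (add_pos_of_pos_of_nonneg (pos_iff_ne_zero.2 hv) zero_le).ne'
  have hexp : Real.exp (-(v * s / (2 * w) * a ^ 2)) ≤ 1 := by
    rw [Real.exp_le_one_iff, neg_nonpos]; positivity
  refine Measure.ext_of_charFun (funext fun t => ?_)
  rw [charFun_conv, charFun_modulatedGaussian hv hη hη1 hq, charFun_modulatedGaussian hw0
    (by positivity) (mul_le_one₀ hη1 (Real.exp_pos _).le hexp) hq, charFun_gaussianReal,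
    ← modulatedEnvelope_mul_exp hw hw0]
  push_cast
  rw [show (t : ℂ) * 0 * Complex.I - s * (t : ℂ) ^ 2 / 2 = -(s * t ^ 2 / 2) by ring]
  ring

/-- The densities compare pointwise: `(1 + η cos y) / (1 + κ) + η + κ ≥ 1`. -/
lemma setwiseLe_modulatedGaussian {m : ℝ} {v : ℝ≥0} (hv : v ≠ 0) (a b : ℝ) {η κ : ℝ} (hη : 0 ≤ η)
    (hη1 : η ≤ 1) (hκ : 0 ≤ κ) :
    SetwiseLe (modulatedGaussian m v a 0 1) (modulatedGaussian m v b η (1 + κ))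
      (ENNReal.ofReal (η + κ)) := by
  intro A hA
  rw [modulatedGaussian, modulatedGaussian, withDensity_apply _ hA, withDensity_apply _ hA]
  have hone : ∫⁻ u in A, ENNReal.ofReal (η + κ) * ENNReal.ofReal (gaussianPDFReal m v u) ≤
      ENNReal.ofReal (η + κ) := by
    rw [lintegral_const_mul _ (by fun_prop)]
    refine mul_le_of_le_one_right zero_le ?_
    rw [← lintegral_gaussianPDFReal_eq_one m hv]
    exact setLIntegral_le_lintegral _ _
  refine le_trans ?_ (add_le_add_right hone _)
  rw [← lintegral_add_left continuous_modulatedPDF.measurable.ennreal_ofReal]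
  refine lintegral_mono fun u => ?_
  have hg := gaussianPDFReal_nonneg m v u
  rw [← ENNReal.ofReal_mul (by positivity), ← ENNReal.ofReal_add
    (modulatedPDF_nonneg hη hη1 (by positivity) u) (by positivity)]
  refine ENNReal.ofReal_le_ofReal ?_
  simp only [modulatedPDF, zero_mul, add_zero, div_one, mul_one]
  rw [mul_comm (η + κ), ← mul_add]
  refine le_mul_of_one_le_right hg ?_
  rw [div_add' _ _ _ (by positivity), le_div_iff₀ (by positivity)]
  nlinarith [Real.neg_one_le_cos (b * (u - m)), mul_nonneg (add_nonneg hη hκ) hκ]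

/-! ### From discrete observations to independent increments -/

lemma IsLevyProcess.map_increments {Ω : Type*} [MeasurableSpace Ω] {X : ℝ≥0 → Ω → ℝ}
    {P : Measure Ω} (h : IsLevyProcess X P) (n : ℕ) :
    P.map (fun ω (i : Fin n) => X ((i : ℕ) + 1 : ℝ≥0) ω - X ((i : ℕ) : ℝ≥0) ω) =
      Measure.pi fun _ : Fin n => P.map (X 1) := by
  have := h.isProbabilityMeasure
  have hind := h.indep_increments n (fun i => ((i : ℕ) : ℝ≥0))
    (fun i j hij => Nat.cast_le.2 hij)
  have hm (t : ℝ≥0) := h.measurable t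
  simp only [Fin.val_succ, Fin.val_castSucc, Nat.cast_add, Nat.cast_one] at hind
  rw [(iIndepFun_iff_map_fun_eq_pi_map fun i => by fun_prop).1 hind]
  congr 1
  funext i
  exact (h.stationary_increments _ 1).map_eq

/-- The vector of partial sums `(y₁, y₁ + y₂, …)`. -/
def partialSums (n : ℕ) (y : Fin n → ℝ) : Fin n → ℝ := fun i => ∑ j ∈ Finset.Iic i, y j

lemma measurable_partialSums (n : ℕ) : Measurable (partialSums n) :=
  measurable_pi_lambda _ fun _ => Finset.measurable_sum _ fun j _ => measurable_pi_apply j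

lemma IsLevyProcess.map_observations {Ω : Type*} [MeasurableSpace Ω] {X : ℝ≥0 → Ω → ℝ}
    {P : Measure Ω} (h : IsLevyProcess X P) (n : ℕ) :
    P.map (observations X n) = (Measure.pi fun _ : Fin n => P.map (X 1)).map (partialSums n) := by
  have hm (t : ℝ≥0) := h.measurable t
  rw [← h.map_increments n, Measure.map_map (measurable_partialSums n)
    (by fun_prop)]
  refine Measure.map_congr ?_
  -- The increments telescope to the observations only where `X 0 ω = 0`.
  filter_upwards [h.zero_ae] with ω hω
  funext i
  have hsum : ∑ j ∈ Finset.Iic i, (X ((j : ℕ) + 1 : ℝ≥0) ω - X ((j : ℕ) : ℝ≥0) ω) =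
      ∑ j ∈ Finset.range (i + 1), (X ((j : ℕ) + 1 : ℝ≥0) ω - X ((j : ℕ) : ℝ≥0) ω) := by
    refine Finset.sum_bij (fun j _ => (j : ℕ)) (fun j hj => ?_) (fun _ _ _ _ => Fin.ext)
      (fun j hj => ?_) (fun _ _ => rfl)
    · simpa [Nat.lt_succ_iff] using hj
    · have hj' : j ≤ i := Nat.lt_succ_iff.1 (Finset.mem_range.1 hj)
      exact ⟨⟨j, hj'.trans_lt i.2⟩, by simpa [Fin.le_def] using hj', rfl⟩
  have htel := Finset.sum_range_sub (fun j : ℕ => X (j : ℝ≥0) ω) (i + 1)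
  simp only [Nat.cast_add, Nat.cast_one, Nat.cast_zero, hω, sub_zero] at htel
  simp only [observations, Function.comp, partialSums]
  rw [hsum, htel]

lemma measurable_observations {Ω : Type*} [MeasurableSpace Ω] {X : ℝ≥0 → Ω → ℝ}
    (h : ∀ t, Measurable (X t)) (n : ℕ) : Measurable (observations X n) :=
  measurable_pi_lambda _ fun _ => h _

/-- Two point lower bound for the estimation of a real parameter from the discrete observations of
one of two Lévy processes. -/
lemma le_meanSquareError_add {Ω₀ Ω₁ : Type*} [MeasurableSpace Ω₀] [MeasurableSpace Ω₁]
    {X₀ : ℝ≥0 → Ω₀ → ℝ} {X₁ : ℝ≥0 → Ω₁ → ℝ} {P₀ : Measure Ω₀} {P₁ : Measure Ω₁}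
    (h₀ : IsLevyProcess X₀ P₀) (h₁ : IsLevyProcess X₁ P₁) {n : ℕ} {ε : ℝ≥0∞}
    (hε : SetwiseLe (P₀.map (X₀ 1)) (P₁.map (X₁ 1)) ε) (hn : n * ε ≤ 2⁻¹)
    {r : (Fin n → ℝ) → ℝ → ℝ} (hr : IsEstimator r) (ρ₀ ρ₁ : ℝ → ℝ) (x : ℝ) :
    ENNReal.ofReal ((ρ₀ x - ρ₁ x) ^ 2 / 8) ≤
      meanSquareError X₀ P₀ ρ₀ r x + meanSquareError X₁ P₁ ρ₁ r x := by
  have := h₀.isProbabilityMeasure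
  have := h₁.isProbabilityMeasure
  have := Measure.isProbabilityMeasure_map (μ := P₀) (h₀.measurable 1).aemeasurable
  have := Measure.isProbabilityMeasure_map (μ := P₁) (h₁.measurable 1).aemeasurable
  have hobs₀ := measurable_observations h₀.measurable n
  have := Measure.isProbabilityMeasure_map (μ := P₀) hobs₀.aemeasurable
  have hle : SetwiseLe (P₀.map (observations X₀ n)) (P₁.map (observations X₁ n)) 2⁻¹ := by
    rw [h₀.map_observations, h₁.map_observations]
    exact ((hε.pi n).map (measurable_partialSums n)).mono hn
  refine (hle.le_lintegral_sq_add (hr x) (ρ₀ x) (ρ₁ x)).trans_eq ?_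
  have hrx := hr x
  rw [lintegral_map (by fun_prop) hobs₀,
    lintegral_map (by fun_prop) (measurable_observations h₁.measurable n)]
  rfl

/-! ### Weighted Fourier integrals -/

lemma lintegral_abs_rpow_mul_exp {β : ℝ} (hβ : 0 < β) {v : ℝ≥0} (hv : v ≠ 0) :
    ∫⁻ t : ℝ, ENNReal.ofReal (|t| ^ β * Real.exp (-(v * t ^ 2 / 2))) =
      ENNReal.ofReal ((v / 2 : ℝ) ^ (-(β + 1) / 2) * Real.Gamma ((β + 1) / 2)) := by
  have hv' : (0 : ℝ) < v / 2 := by positivity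
  have h1 := integral_rpow_mul_exp_neg_mul_rpow two_pos (q := β) (by linarith) hv'
  have h2 := integral_comp_abs (f := fun t : ℝ => t ^ β * Real.exp (-(v / 2) * t ^ (2 : ℝ)))
  have hfun (t : ℝ) : |t| ^ β * Real.exp (-(v / 2) * |t| ^ (2 : ℝ)) =
      |t| ^ β * Real.exp (-(v * t ^ 2 / 2)) := by
    rw [Real.rpow_two, sq_abs]; ring_nf
  simp_rw [hfun] at h2
  rw [h1] at h2
  have hΓ : 0 < Real.Gamma ((β + 1) / 2) := Real.Gamma_pos_of_pos (by linarith)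
  have hp : 0 < (v / 2 : ℝ) ^ (-(β + 1) / 2) := Real.rpow_pos_of_pos hv' _
  have hint : Integrable fun t : ℝ => |t| ^ β * Real.exp (-(v * t ^ 2 / 2)) := by
    -- A function that is not integrable has integral `0` by convention, so a positive value forces
    -- integrability.
    refine not_imp_comm.1 integral_undef ?_
    rw [h2]
    positivity
  rw [← ofReal_integral_eq_lintegral_ofReal hint (ae_of_all _ fun t => by positivity), h2]
  congr 1
  ring

/-- A wide Gaussian has a concentrated transform: the integral tends to `0` as `v` grows, so any
budget `δ` can be met. -/
lemma exists_lintegral_abs_rpow_mul_exp_le {β δ : ℝ} (hβ : 0 < β) (hδ : 0 < δ) :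
    ∃ v : ℝ≥0, v ≠ 0 ∧
      ∫⁻ t : ℝ, ENNReal.ofReal (|t| ^ β * Real.exp (-(v * t ^ 2 / 2))) ≤ ENNReal.ofReal δ := by
  have h1 : Tendsto (fun b : ℝ => b ^ (-((β + 1) / 2)) * Real.Gamma ((β + 1) / 2)) atTop
      (𝓝 (0 * Real.Gamma ((β + 1) / 2))) :=
    (tendsto_rpow_neg_atTop (by linarith)).mul_const _
  rw [zero_mul] at h1
  obtain ⟨b, hb, hb0⟩ := ((h1.eventually_le_const hδ).and (eventually_gt_atTop 0)).exists
  have hv : Real.toNNReal (2 * b) ≠ 0 := (Real.toNNReal_pos.2 (by linarith)).ne'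
  refine ⟨Real.toNNReal (2 * b), hv, ?_⟩
  rw [lintegral_abs_rpow_mul_exp hβ hv, Real.coe_toNNReal _ (by linarith)]
  refine ENNReal.ofReal_le_ofReal ?_
  rwa [mul_div_cancel_left₀ _ two_ne_zero, neg_div]

lemma lintegral_exp_neg_mul_sq {v : ℝ≥0} (hv : v ≠ 0) :
    ∫⁻ t : ℝ, ENNReal.ofReal (Real.exp (-(v * t ^ 2 / 2))) =
      ENNReal.ofReal (√(Real.pi / (v / 2))) := by
  have hv' : (0 : ℝ) < v / 2 := by positivity
  have hfun (t : ℝ) : Real.exp (-(v * t ^ 2 / 2)) = Real.exp (-(v / 2) * t ^ 2) := by ring_nf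
  simp_rw [hfun]
  rw [← integral_gaussian, ofReal_integral_eq_lintegral_ofReal (integrable_exp_neg_mul_sq hv')
    (ae_of_all _ fun t => by positivity)]

lemma abs_sub_rpow_le {β : ℝ} (hβ : 0 < β) (t a : ℝ) :
    |t - a| ^ β ≤ 2 ^ β * (|t| ^ β + |a| ^ β) := by
  have hle : |t - a| ≤ 2 * max |t| |a| := by
    have := abs_sub t a
    linarith [le_max_left |t| |a|, le_max_right |t| |a|]
  calc |t - a| ^ β ≤ (2 * max |t| |a|) ^ β := by gcongr
    _ = 2 ^ β * max |t| |a| ^ β := Real.mul_rpow two_pos.le (by positivity)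
    _ ≤ _ := by
      gcongr
      rcases max_choice |t| |a| with h | h <;> rw [h]
      · exact le_add_of_nonneg_right (by positivity)
      · exact le_add_of_nonneg_left (by positivity)

lemma lintegral_abs_rpow_mul_exp_shift_le {β : ℝ} (hβ : 0 < β) {v : ℝ≥0} (hv : v ≠ 0) {δ : ℝ}
    (hδ : 0 < δ)
    (h : ∫⁻ t : ℝ, ENNReal.ofReal (|t| ^ β * Real.exp (-(v * t ^ 2 / 2))) ≤ ENNReal.ofReal δ)
    (a : ℝ) :
    ∫⁻ t : ℝ, ENNReal.ofReal (|t| ^ β * Real.exp (-(v * (t + a) ^ 2 / 2))) ≤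
      ENNReal.ofReal (2 ^ β * (δ + |a| ^ β * √(Real.pi / (v / 2)))) := by
  have hshift := lintegral_sub_right_eq_self (μ := volume)
    (fun t : ℝ => ENNReal.ofReal (|t| ^ β * Real.exp (-(v * (t + a) ^ 2 / 2)))) a
  rw [← hshift]
  simp only [sub_add_cancel]
  calc ∫⁻ t : ℝ, ENNReal.ofReal (|t - a| ^ β * Real.exp (-(v * t ^ 2 / 2)))
      ≤ ∫⁻ t : ℝ, ENNReal.ofReal (2 ^ β) *
        (ENNReal.ofReal (|t| ^ β * Real.exp (-(v * t ^ 2 / 2))) +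
          ENNReal.ofReal (|a| ^ β) * ENNReal.ofReal (Real.exp (-(v * t ^ 2 / 2)))) := by
        refine lintegral_mono fun t => ?_
        rw [← ENNReal.ofReal_mul (by positivity), ← ENNReal.ofReal_add (by positivity)
          (by positivity), ← ENNReal.ofReal_mul (by positivity)]
        refine ENNReal.ofReal_le_ofReal ?_
        rw [← add_mul, ← mul_assoc]
        gcongr
        exact abs_sub_rpow_le hβ t a
    _ ≤ _ := by
        rw [lintegral_const_mul _ (by fun_prop), lintegral_add_right _ (by fun_prop),
          lintegral_const_mul _ (by fun_prop), lintegral_exp_neg_mul_sq hv,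
          ENNReal.ofReal_mul (p := 2 ^ β) (by positivity),
          ENNReal.ofReal_add (p := δ) (by positivity) (by positivity),
          ENNReal.ofReal_mul (p := |a| ^ β) (by positivity)]
        gcongr

lemma modulatedEnvelope_nonneg {v : ℝ≥0} {a η : ℝ} (hη : 0 ≤ η) (t : ℝ) :
    0 ≤ modulatedEnvelope v a η t := by
  unfold modulatedEnvelope
  positivity

lemma lintegral_abs_rpow_mul_modulatedEnvelope_le {β : ℝ} (hβ : 0 < β) {v : ℝ≥0} (hv : v ≠ 0)
    {δ : ℝ} (hδ : 0 < δ)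
    (h : ∫⁻ t : ℝ, ENNReal.ofReal (|t| ^ β * Real.exp (-(v * t ^ 2 / 2))) ≤ ENNReal.ofReal δ)
    (a : ℝ) {η : ℝ} (hη : 0 ≤ η) :
    ∫⁻ t : ℝ, ENNReal.ofReal (|t| ^ β * modulatedEnvelope v a η t) ≤
      ENNReal.ofReal (δ + η * (2 ^ β * (δ + |a| ^ β * √(Real.pi / (v / 2))))) := by
  have hfun (t : ℝ) : ENNReal.ofReal (|t| ^ β * modulatedEnvelope v a η t) =
      ENNReal.ofReal (|t| ^ β * Real.exp (-(v * t ^ 2 / 2))) + ENNReal.ofReal (η / 2) *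
        (ENNReal.ofReal (|t| ^ β * Real.exp (-(v * (t + a) ^ 2 / 2))) +
          ENNReal.ofReal (|t| ^ β * Real.exp (-(v * (t + -a) ^ 2 / 2)))) := by
    rw [← ENNReal.ofReal_add (by positivity) (by positivity), ← ENNReal.ofReal_mul (by positivity),
      ← ENNReal.ofReal_add (by positivity) (by positivity), modulatedEnvelope]
    congr 1
    rw [← sub_eq_add_neg]
    ring
  have h1 := lintegral_abs_rpow_mul_exp_shift_le hβ hv hδ h a
  have h2 := lintegral_abs_rpow_mul_exp_shift_le hβ hv hδ h (-a)
  rw [abs_neg] at h2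
  simp_rw [hfun]
  rw [lintegral_add_left (by fun_prop), lintegral_const_mul _ (by fun_prop),
    lintegral_add_left (by fun_prop), ENNReal.ofReal_add (p := δ) (by positivity) (by positivity)]
  refine add_le_add h ((mul_le_mul_right (add_le_add h1 h2) _).trans_eq ?_)
  rw [← ENNReal.ofReal_add (by positivity) (by positivity), ← ENNReal.ofReal_mul (by positivity)]
  congr 1
  ring

/-! ### The competing Lévy triplets -/

/-- The Lévy triplet `(0, s², l f)`, where `f` is a modulated Gaussian density. -/
noncomputable def modulatedTriplet {s l : ℝ} (hs : 0 ≤ s) (hl : 0 ≤ l) (m : ℝ) (v : ℝ≥0) (a : ℝ)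
    {η q : ℝ} (hη : 0 ≤ η) (hη1 : η ≤ 1) (hq : 0 < q) : LevyTriplet where
  γ := 0
  σ := s
  ρ u := l * modulatedPDF m v a η q u
  σ_nonneg := hs
  ρ_nonneg u := mul_nonneg hl (modulatedPDF_nonneg hη hη1 hq u)
  ρ_integrable := integrable_modulatedPDF.const_mul l

section

variable {s l : ℝ} (hs : 0 ≤ s) (hl : 0 < l) (m : ℝ) {v : ℝ≥0} (a : ℝ) {η q : ℝ} (hη : 0 ≤ η)
  (hη1 : η ≤ 1) (hq : 0 < q)

lemma integral_modulatedPDF [IsProbabilityMeasure (modulatedGaussian m v a η q)] (hη : 0 ≤ η)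
    (hη1 : η ≤ 1) (hq : 0 < q) : ∫ u, modulatedPDF m v a η q u = 1 := by
  have h := integral_modulatedGaussian (m := m) (v := v) (a := a) hη hη1 hq fun _ => 1
  simp only [integral_const, probReal_univ, one_smul, one_mul] at h
  rw [integral_complex_ofReal] at h
  exact_mod_cast h.symm

lemma mass_modulatedTriplet [IsProbabilityMeasure (modulatedGaussian m v a η q)] :
    (modulatedTriplet hs hl.le m v a hη hη1 hq).mass = l := by
  simp only [LevyTriplet.mass, modulatedTriplet]
  rw [integral_const_mul, integral_modulatedPDF m a hη hη1 hq, mul_one]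

lemma jumpCharFun_modulatedTriplet [IsProbabilityMeasure (modulatedGaussian m v a η q)] (t : ℝ) :
    (modulatedTriplet hs hl.le m v a hη hη1 hq).jumpCharFun t =
      charFun (modulatedGaussian m v a η q) t := by
  rw [charFun_apply_real, integral_modulatedGaussian hη hη1 hq]
  simp only [LevyTriplet.jumpCharFun, LevyTriplet.jumpDensity,
    mass_modulatedTriplet hs hl m a hη hη1 hq]
  simp only [modulatedTriplet, mul_div_cancel_left₀ _ hl.ne']
  refine integral_congr_ae (ae_of_all _ fun u => ?_)
  simp only
  congr 2
  ring

lemma exponent_modulatedTriplet [IsProbabilityMeasure (modulatedGaussian m v a η q)] (t : ℝ) :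
    (modulatedTriplet hs hl.le m v a hη hη1 hq).exponent t =
      -(s ^ 2 * t ^ 2 / 2) + l * (charFun (modulatedGaussian m v a η q) t - 1) := by
  have hint : Integrable (fun u : ℝ => Complex.exp (t * u * Complex.I))
      (modulatedGaussian m v a η q) := by
    refine Integrable.of_bound (C := 1) (by fun_prop) (ae_of_all _ fun u => ?_)
    rw [← Complex.ofReal_mul, Complex.norm_exp_ofReal_mul_I]
  have h1 : charFun (modulatedGaussian m v a η q) t - 1 =
      ∫ u : ℝ, (Complex.exp (t * u * Complex.I) - 1) ∂modulatedGaussian m v a η q := by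
    rw [integral_sub hint (integrable_const _), charFun_apply_real]
    simp
  rw [h1, integral_modulatedGaussian hη hη1 hq, ← integral_const_mul]
  simp only [LevyTriplet.exponent, modulatedTriplet]
  rw [Complex.ofReal_zero, mul_zero, zero_mul, zero_sub]
  congr 1
  refine integral_congr_ae (ae_of_all _ fun u => ?_)
  simp only
  rw [show Complex.I * t * u = t * u * Complex.I by ring]
  push_cast
  ring

/-- The exponent fixes the characteristic function of `X 1`, hence its law, whichever process
realises the triplet. -/
lemma map_one_modulatedTriplet [IsProbabilityMeasure (modulatedGaussian m v a η q)]
    {Ω : Type*} [MeasurableSpace Ω] {X : ℝ≥0 → Ω → ℝ} {P : Measure Ω}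
    (h : IsLevyProcessWithTriplet X P (modulatedTriplet hs hl.le m v a hη hη1 hq)) :
    P.map (X 1) = compoundPoisson l (modulatedGaussian m v a η q)
      (gaussianReal 0 (Real.toNNReal (s ^ 2))) := by
  have := h.isProbabilityMeasure
  have := isProbabilityMeasure_compoundPoisson hl.le (modulatedGaussian m v a η q)
    (gaussianReal 0 (Real.toNNReal (s ^ 2)))
  refine Measure.ext_of_charFun (funext fun t => ?_)
  rw [h.charFun_one, charFun_compoundPoisson hl.le, exponent_modulatedTriplet hs hl,
    charFun_gaussianReal,
    add_comm, Complex.exp_add, Real.coe_toNNReal _ (sq_nonneg s)]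
  congr 2
  push_cast
  ring

lemma modulatedTriplet_mem_levyClass [IsProbabilityMeasure (modulatedGaussian m v a η q)]
    {Γ Λ β L δ : ℝ} (hΓ : 0 ≤ Γ) (hs0 : 0 < s) (hlΛ : l ≤ Λ) (hβ : 0 < β) (hv : v ≠ 0) (hq1 : 1 ≤ q)
    (hδ : 0 < δ)
    (h : ∫⁻ t : ℝ, ENNReal.ofReal (|t| ^ β * Real.exp (-(v * t ^ 2 / 2))) ≤ ENNReal.ofReal δ)
    (hL : δ + η * (2 ^ β * (δ + |a| ^ β * √(Real.pi / (v / 2)))) ≤ L) :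
    modulatedTriplet hs hl.le m v a hη hη1 hq ∈ levyClass Γ s Λ β L := by
  refine ⟨by simpa [modulatedTriplet] using hΓ, ⟨hs0, le_rfl⟩, ?_,
    continuous_const.mul continuous_modulatedPDF, ?_⟩
  · rw [mass_modulatedTriplet hs hl]
    exact ⟨hl, hlΛ⟩
  · refine le_trans (lintegral_mono fun t => ENNReal.ofReal_le_ofReal ?_)
      ((lintegral_abs_rpow_mul_modulatedEnvelope_le hβ hv hδ h a hη).trans
        (ENNReal.ofReal_le_ofReal hL))
    gcongr
    have henv := modulatedEnvelope_nonneg (v := v) (a := a) hη t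
    rw [jumpCharFun_modulatedTriplet hs hl, charFun_modulatedGaussian hv hη hη1 hq, norm_mul,
      ← Complex.ofReal_mul, Complex.norm_exp_ofReal_mul_I, one_mul, Complex.norm_real,
      Real.norm_of_nonneg (div_nonneg henv hq.le)]
    exact div_le_self henv hq1

end

/-! ### Closeness of the laws, separation at the point, and the theorem -/

lemma setwiseLe_compoundPoisson_modulatedGaussian {m : ℝ} {v s w : ℝ≥0} (hv : v ≠ 0)
    (hw : w = v + s) {a η l : ℝ} (hη : 0 ≤ η) (hη1 : η ≤ 1) (hl : 0 ≤ l) :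
    SetwiseLe (compoundPoisson l (modulatedGaussian m v a 0 1) (gaussianReal 0 s))
      (compoundPoisson l
        (modulatedGaussian m v a η (1 + η * Real.exp (-(v * a ^ 2 / 2)))) (gaussianReal 0 s))
      (ENNReal.ofReal (2 * l * Real.exp (-(v * s / (2 * w) * a ^ 2)))) := by
  have hw0 : w ≠ 0 := by
    rw [hw]; exact (add_pos_of_pos_of_nonneg (pos_iff_ne_zero.2 hv) zero_le).ne'
  have hq : 0 < 1 + η * Real.exp (-(v * a ^ 2 / 2)) := by positivity
  have hE1 : Real.exp (-(v * s / (2 * w) * a ^ 2)) ≤ 1 := by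
    rw [Real.exp_le_one_iff, neg_nonpos]; positivity
  -- The normalisation differs from `1` by at most the damping factor, since `s / w ≤ 1`.
  have hκ : Real.exp (-(v * a ^ 2 / 2)) ≤ Real.exp (-(v * s / (2 * w) * a ^ 2)) := by
    refine Real.exp_le_exp.2 (neg_le_neg ?_)
    have hsw : (s : ℝ) ≤ w := by rw [hw]; push_cast; linarith [v.2]
    have hw' : (0 : ℝ) < w := by positivity
    calc v * s / (2 * w) * a ^ 2 = v * a ^ 2 / 2 * (s / w) := by field_simp
      _ ≤ v * a ^ 2 / 2 := mul_le_of_le_one_right (by positivity) ((div_le_one hw').2 hsw)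
  have := isProbabilityMeasure_modulatedGaussian (m := m) (a := a) hv hη hη1 rfl
  have := isProbabilityMeasure_modulatedGaussian (m := m) (v := v) (a := a) (η := 0) (q := 1) hv
    le_rfl zero_le_one (by simp)
  have h : SetwiseLe (modulatedGaussian m v a 0 1 ∗ gaussianReal 0 s)
      (modulatedGaussian m v a η (1 + η * Real.exp (-(v * a ^ 2 / 2))) ∗ gaussianReal 0 s)
      (ENNReal.ofReal (2 * Real.exp (-(v * s / (2 * w) * a ^ 2)))) := by
    rw [modulatedGaussian_conv_gaussianReal hv hw le_rfl zero_le_one one_pos,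
      modulatedGaussian_conv_gaussianReal hv hw hη hη1 hq, zero_mul]
    refine (setwiseLe_modulatedGaussian hw0 _ _ (by positivity)
      (mul_le_one₀ hη1 (Real.exp_pos _).le hE1) (by positivity)).mono
      (ENNReal.ofReal_le_ofReal ?_)
    rw [two_mul (Real.exp _)]
    exact add_le_add (mul_le_of_le_one_left (Real.exp_pos _).le hη1)
      ((mul_le_of_le_one_left (Real.exp_pos _).le hη1).trans hκ)
  refine (h.compoundPoisson hl).mono (le_of_eq ?_)
  rw [← ENNReal.ofReal_mul hl]
  congr 1
  ring

/-- At the centre the cosine equals `1`, and `(1 + η) / (1 + η κ) - 1 = η (1 - κ) / (1 + η κ) ≥ η /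
3`. -/
lemma modulatedPDF_sub_ge (m : ℝ) (v : ℝ≥0) (a : ℝ) {η κ : ℝ} (hη : 0 ≤ η) (hη1 : η ≤ 1)
    (hκ : 0 ≤ κ) (hκ1 : κ ≤ 1 / 2) :
    gaussianPDFReal m v m * (η / 4) ≤
      modulatedPDF m v a η (1 + η * κ) m - modulatedPDF m v a 0 1 m := by
  have h : modulatedPDF m v a η (1 + η * κ) m - modulatedPDF m v a 0 1 m =
      gaussianPDFReal m v m * ((1 + η) / (1 + η * κ) - 1) := by
    simp [modulatedPDF]
    ring
  rw [h]
  refine mul_le_mul_of_nonneg_left ?_ (gaussianPDFReal_nonneg _ _ _)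
  have hq : 0 < 1 + η * κ := by positivity
  rw [div_sub_one hq.ne', le_div_iff₀ hq]
  nlinarith [mul_nonneg hη hκ, mul_nonneg hη (sub_nonneg.2 hκ1), mul_nonneg hη (sub_nonneg.2 hη1)]

theorem theorem2p4 (Γ S Λ β L : ℝ) (hΓ : 0 < Γ) (hS : 0 < S) (hΛ : 0 < Λ) (hβ : 0 < β)
    (hL : 0 < L) (x : ℝ) :
    ∃ c : ℝ, 0 < c ∧ ∀ (Ω : LevyTriplet → Type*) [∀ T, MeasurableSpace (Ω T)]
      (P : ∀ T, Measure (Ω T)) (X : ∀ T, ℝ≥0 → Ω T → ℝ),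
      (∀ T ∈ levyClass Γ S Λ β L, IsLevyProcessWithTriplet (X T) (P T) T) →
      ∀ n : ℕ, 2 ≤ n →
        ENNReal.ofReal (c * Real.log n ^ (-β)) ≤
          ⨅ (r : (Fin n → ℝ) → ℝ → ℝ) (_ : IsEstimator r),
            ⨆ T ∈ levyClass Γ S Λ β L, meanSquareError (X T) (P T) T.ρ r x := by
  -- The unmodulated Gaussian uses half of the budget `L`; the other half is left for the
  -- modulation.
  obtain ⟨v, hv, hM⟩ := exists_lintegral_abs_rpow_mul_exp_le hβ (half_pos hL)
  set s : ℝ≥0 := Real.toNNReal (S ^ 2) with hs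
  have hs0 : 0 < s := Real.toNNReal_pos.2 (by positivity)
  obtain ⟨w, hw⟩ : ∃ w, w = v + s := ⟨_, rfl⟩
  have hw0 : 0 < w := by rw [hw]; positivity
  set C : ℝ := v * s / (2 * w) with hC
  have hC0 : 0 < C := by positivity
  set G : ℝ := √(Real.pi / (v / 2)) with hG
  have hG0 : 0 < G := by positivity
  -- The frequency for `n = 2`, the smallest one used; it makes the bounds below uniform in `n`.
  set a₀ : ℝ := √(Real.log 2 / C) with ha₀
  have hlog2 : 0 < Real.log 2 := Real.log_pos one_lt_two
  have ha₀0 : 0 < a₀ := by positivity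
  set K : ℝ := 2 ^ β * (L / 2 * a₀ ^ (-β) + G) with hK
  have hK0 : 0 < K := by positivity
  -- The first bound gives `η ≤ 1`, hence a nonnegative density; the second keeps the modulation
  -- within `L / 2`.
  set η₀ : ℝ := min (a₀ ^ β) (L / 2 / K) with hη₀
  have hη₀0 : 0 < η₀ := by positivity
  -- With `l ≤ 1 / 4` the total cost `n * (2 * l / n)` is at most `1 / 2`.
  set l : ℝ := min Λ (1 / 4) with hl
  have hl0 : 0 < l := by positivity
  set D : ℝ := l * gaussianPDFReal x v x with hD
  have hD0 : 0 < D := mul_pos hl0 (gaussianPDFReal_pos x v x hv)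
  refine ⟨(D * η₀ / 4) ^ 2 / 16 * C ^ β, by positivity, ?_⟩
  intro Ω _ P X hX n hn
  have hn2 : (2 : ℝ) ≤ n := by exact_mod_cast hn
  have hn0 : (0 : ℝ) < n := by linarith
  have hlog : Real.log 2 ≤ Real.log n := Real.log_le_log two_pos hn2
  have hlog0 : 0 < Real.log n := hlog2.trans_le hlog
  -- The frequency solves `exp (-(C a²)) = 1 / n`.
  obtain ⟨a, ha⟩ : ∃ a, a = √(Real.log n / C) := ⟨_, rfl⟩
  have ha_sq : a ^ 2 = Real.log n / C := by rw [ha, Real.sq_sqrt (by positivity)]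
  have ha_ge : a₀ ≤ a := by rw [ha, ha₀]; gcongr
  have ha0 : 0 < a := ha₀0.trans_le ha_ge
  have hexp : Real.exp (-(C * a ^ 2)) = (n : ℝ)⁻¹ := by
    rw [ha_sq, mul_div_cancel₀ _ hC0.ne', Real.exp_neg, Real.exp_log hn0]
  obtain ⟨η, hη⟩ : ∃ η, η = η₀ * a ^ (-β) := ⟨_, rfl⟩
  have hη0 : 0 ≤ η := by rw [hη]; positivity
  have ha_neg : a ^ (-β) ≤ a₀ ^ (-β) :=
    Real.rpow_le_rpow_of_nonpos ha₀0 ha_ge (by linarith)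
  have hη1 : η ≤ 1 := by
    calc η ≤ a₀ ^ β * a₀ ^ (-β) := by
          rw [hη]
          exact mul_le_mul (min_le_left _ _) ha_neg (by positivity) (by positivity)
      _ = 1 := by rw [← Real.rpow_add ha₀0, add_neg_cancel, Real.rpow_zero]
  have hηL : η * (2 ^ β * (L / 2 + |a| ^ β * G)) ≤ L / 2 := by
    have h1 : a ^ (-β) * a ^ β = 1 := by rw [← Real.rpow_add ha0, neg_add_cancel, Real.rpow_zero]
    calc η * (2 ^ β * (L / 2 + |a| ^ β * G))
        = η₀ * (2 ^ β * (L / 2 * a ^ (-β) + a ^ (-β) * a ^ β * G)) := by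
          rw [hη, abs_of_pos ha0]; ring
      _ ≤ η₀ * K := by
          rw [h1, one_mul, hK]
          gcongr
      _ ≤ L / 2 / K * K := by gcongr; exact min_le_right _ _
      _ = L / 2 := div_mul_cancel₀ _ hK0.ne'
  obtain ⟨κ, hκ⟩ : ∃ κ, κ = Real.exp (-(v * a ^ 2 / 2)) := ⟨_, rfl⟩
  have hκ0 : 0 ≤ κ := by rw [hκ]; positivity
  have hκ2 : κ ≤ 1 / 2 := by
    have hsw : (s : ℝ) ≤ w := by rw [hw]; push_cast; linarith [v.2]
    have hCv : C ≤ v / 2 := by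
      rw [hC, div_le_div_iff₀ (by positivity) two_pos]
      nlinarith [v.2]
    calc κ ≤ Real.exp (-(C * a ^ 2)) := by
          rw [hκ]
          refine Real.exp_le_exp.2 (neg_le_neg ?_)
          nlinarith [sq_nonneg a]
      _ = (n : ℝ)⁻¹ := hexp
      _ ≤ 1 / 2 := by rw [one_div]; gcongr
  have hq1 : 1 ≤ 1 + η * κ := le_add_of_nonneg_right (by positivity)
  have hq0 : 0 < 1 + η * κ := one_pos.trans_le hq1
  have hF₀ := isProbabilityMeasure_modulatedGaussian (m := x) (v := v) (a := a) (η := 0) (q := 1) hv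
    le_rfl zero_le_one (by simp)
  have hF₁ := isProbabilityMeasure_modulatedGaussian (m := x) (a := a) (q := 1 + η * κ) hv hη0 hη1
    (by rw [hκ])
  set T₀ := modulatedTriplet hS.le hl0.le x v a le_rfl zero_le_one one_pos with hT₀
  set T₁ := modulatedTriplet hS.le hl0.le x v a hη0 hη1 hq0 with hT₁
  -- With `η = 0` the frequency plays no role: `T₀` has a plain Gaussian jump density.
  have hmem₀ : T₀ ∈ levyClass Γ S Λ β L :=
    modulatedTriplet_mem_levyClass hS.le hl0 x a le_rfl zero_le_one one_pos hΓ.le hS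
      (min_le_left _ _) hβ hv le_rfl (half_pos hL) hM (by linarith)
  have hmem₁ : T₁ ∈ levyClass Γ S Λ β L :=
    modulatedTriplet_mem_levyClass hS.le hl0 x a hη0 hη1 hq0 hΓ.le hS
      (min_le_left _ _) hβ hv hq1 (half_pos hL) hM (by rw [← hG]; linarith)
  have hsw : SetwiseLe ((P T₀).map (X T₀ 1)) ((P T₁).map (X T₁ 1))
      (ENNReal.ofReal (2 * l * Real.exp (-(C * a ^ 2)))) := by
    rw [map_one_modulatedTriplet hS.le hl0 x a le_rfl zero_le_one one_pos (hX T₀ hmem₀),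
      map_one_modulatedTriplet hS.le hl0 x a hη0 hη1 hq0 (hX T₁ hmem₁), hκ]
    exact setwiseLe_compoundPoisson_modulatedGaussian hv hw hη0 hη1 hl0.le
  have hsmall : (n : ℝ≥0∞) * ENNReal.ofReal (2 * l * Real.exp (-(C * a ^ 2))) ≤ 2⁻¹ := by
    rw [hexp, ← ENNReal.ofReal_natCast n, ← ENNReal.ofReal_mul hn0.le,
      ← ENNReal.ofReal_ofNat 2, ← ENNReal.ofReal_inv_of_pos two_pos]
    refine ENNReal.ofReal_le_ofReal ?_
    rw [mul_comm, inv_mul_cancel_right₀ hn0.ne']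
    linarith [min_le_right Λ (1 / 4)]
  have hdiff : D * (η / 4) ≤ T₁.ρ x - T₀.ρ x := by
    have := modulatedPDF_sub_ge x v a hη0 hη1 hκ0 hκ2
    calc D * (η / 4) = l * (gaussianPDFReal x v x * (η / 4)) := by rw [hD]; ring
      _ ≤ l * (modulatedPDF x v a η (1 + η * κ) x - modulatedPDF x v a 0 1 x) := by gcongr
      _ = T₁.ρ x - T₀.ρ x := by rw [mul_sub]; rfl
  have hrate : (D * η₀ / 4) ^ 2 / 16 * C ^ β * Real.log n ^ (-β) = (D * (η / 4)) ^ 2 / 16 := by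
    have h1 : (a ^ (-β)) ^ 2 = C ^ β * Real.log n ^ (-β) := by
      rw [← Real.rpow_natCast, ← Real.rpow_mul ha0.le, mul_comm, Real.rpow_mul ha0.le,
        Real.rpow_natCast, ha_sq, Real.div_rpow hlog0.le hC0.le, Real.rpow_neg hC0.le,
        div_inv_eq_mul, mul_comm]
    rw [mul_assoc, ← h1, hη]
    ring
  refine le_iInf₂ fun r hr => ?_
  have hlow := le_meanSquareError_add (hX T₀ hmem₀).1 (hX T₁ hmem₁).1
    hsw hsmall hr T₀.ρ T₁.ρ x
  set M := ⨆ T ∈ levyClass Γ S Λ β L, meanSquareError (X T) (P T) T.ρ r x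
  have hM₀ : meanSquareError (X T₀) (P T₀) T₀.ρ r x ≤ M :=
    le_iSup₂ (f := fun T (_ : T ∈ levyClass Γ S Λ β L) =>
      meanSquareError (X T) (P T) T.ρ r x) T₀ hmem₀
  have hM₁ : meanSquareError (X T₁) (P T₁) T₁.ρ r x ≤ M :=
    le_iSup₂ (f := fun T (_ : T ∈ levyClass Γ S Λ β L) =>
      meanSquareError (X T) (P T) T.ρ r x) T₁ hmem₁
  -- The supremum dominates both risks, hence their average; this turns the `8` of the two point
  -- bound into `16`.
  have h2 : 2 * ENNReal.ofReal ((D * (η / 4)) ^ 2 / 16) ≤ 2 * M := by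
    calc 2 * ENNReal.ofReal ((D * (η / 4)) ^ 2 / 16)
        = ENNReal.ofReal ((D * (η / 4)) ^ 2 / 8) := by
          rw [← ENNReal.ofReal_ofNat 2, ← ENNReal.ofReal_mul two_pos.le]
          congr 1
          ring
      _ ≤ ENNReal.ofReal ((T₀.ρ x - T₁.ρ x) ^ 2 / 8) := by
          refine ENNReal.ofReal_le_ofReal ?_
          rw [← neg_sq (T₀.ρ x - T₁.ρ x), neg_sub]
          gcongr
      _ ≤ 2 * M := hlow.trans (by rw [two_mul]; exact add_le_add hM₀ hM₁)
  rw [hrate]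
  exact (ENNReal.mul_le_mul_iff_right two_ne_zero (by simp)).1 h2
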